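/- For $n\in\mathbb{N}$ let $q_n=x_1^2+\cdots+x_n^2\in\mathbb{C}[x_1,\dots,x_n]$. For a homogeneous polynomial $f\in\mathbb{C}[x_1,\dots,x_n]$ of degree $d$, the (Waring) rank $\operatorname{rk} f$ is the smallest $r\in\mathbb{N}$ such that $f=\sum_{j=1}^r l_j^d$ for some $r$ different linear forms $l_1,\dots,l_r\in\mathbb{C}[x_1,\dots,x_n]$, and the border rank $\operatorname{brk} f$ is the smallest $r\in\mathbb{N}$ such that $f$ lies in the Zariski closure, in the affine space $\mathbb{C}[x_1,\dots,x_n]_d$ of forms of degree $d$, of the set of forms of rank at most $r$. Then for every $s\in\mathbb{N}$, $$\lim_{n\to+\infty}\log_n\bigl(\operatorname{rk}(q_n^s)\bigr)=\lim_{n\to+\infty}\log_n\bigl(\operatorname{brk}(q_n^s)\bigr)=s,$$ where $q_n^s$ is regarded as a form of degree $2s$ in $n$ variables. -/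

import Mathlib

open Filter Topology

/-- The quadratic form `x₁² + ⋯ + xₙ²` in `n` variables over `ℂ`. -/
noncomputable def quadForm (n : ℕ) : MvPolynomial (Fin n) ℂ :=
  ∑ i, MvPolynomial.X i ^ 2

/-- `f` is a sum of `d`-th powers of `r` different linear forms, i.e. it has a Waring
decomposition of size `r`. (A linear form is a homogeneous polynomial of degree `1`,
possibly zero, that is, a point of `ℂⁿ`.) -/
def HasWaringDecomposition {n : ℕ} (d : ℕ) (f : MvPolynomial (Fin n) ℂ) (r : ℕ) : Prop :=
  ∃ l : Fin r → MvPolynomial (Fin n) ℂ,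
    Function.Injective l ∧ (∀ j, (l j).IsHomogeneous 1) ∧ f = ∑ j, l j ^ d

/-- The Waring rank of a form `f` of degree `d`: the least size of a Waring decomposition. -/
noncomputable def waringRank {n : ℕ} (d : ℕ) (f : MvPolynomial (Fin n) ℂ) : ℕ :=
  sInf {r | HasWaringDecomposition d f r}

/-- The forms of degree `d` in `n` variables whose Waring rank is at most `r`. The rank is
bounded through the existence of a decomposition, so that a form without any decomposition
(this happens only for `d = 0`) is never counted. -/
def formsOfRankLE (n d r : ℕ) : Set (MvPolynomial (Fin n) ℂ) :=
  {g | ∃ k ≤ r, HasWaringDecomposition d g k}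

/-- The coefficient vector of a form of degree `d`, indexed by the monomials of degree `d`:
these are the coordinates that identify `ℂ[x₁, …, xₙ]_d` with an affine space. -/
noncomputable def formCoords {n : ℕ} (d : ℕ) (f : MvPolynomial (Fin n) ℂ) :
    {m : Fin n →₀ ℕ // m.degree = d} → ℂ :=
  fun m => f.coeff m.1

/-- The Zariski closure, inside the affine space `ℂ[x₁, …, xₙ]_d`, of a set `S` of forms of
degree `d`: the forms of degree `d` at which every polynomial in the coefficients that
vanishes on `S` vanishes. -/
def zariskiClosure {n : ℕ} (d : ℕ) (S : Set (MvPolynomial (Fin n) ℂ)) :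
    Set (MvPolynomial (Fin n) ℂ) :=
  {f | f.IsHomogeneous d ∧
    ∀ P : MvPolynomial {m : Fin n →₀ ℕ // m.degree = d} ℂ,
      (∀ g ∈ S, MvPolynomial.eval (formCoords d g) P = 0) →
        MvPolynomial.eval (formCoords d f) P = 0}

/-- The border rank of a form `f` of degree `d`: the least `r` such that `f` lies in the Zariski
closure of the set of forms of degree `d` of Waring rank at most `r`. -/
noncomputable def borderRank {n : ℕ} (d : ℕ) (f : MvPolynomial (Fin n) ℂ) : ℕ :=
  sInf {r | f ∈ zariskiClosure d (formsOfRankLE n d r)}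

/-! Both limits follow from `n.choose s ≤ brk ≤ rk ≤ C * n ^ s` for `n ≥ 1`, with `C` depending only
on `s`.

Lower bound: on squarefree monomials the catalecticant of `q_n^s` is diagonal and invertible of size
`n.choose s`, while a sum of `r` powers gives rank at most `r`. The determinant is polynomial in the
coefficients, so the bound survives Zariski closure (`choose_le_of_mem_zariskiClosure`).

Upper bound: pick scalars `c_k` whose power sums up to degree `2s` vanish except in degree 2. The
variables `y = c_k x_i` inherit this, so the average of `(∑ ± y)^(2s)` over all signs is a Gaussian
moment, a multiple of `q_n^s` (`sum_signs_pow`). That average needs only `2s`-wise independent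
signs, which the characters of a group of order `O(n^s)` built from a BCH code supply
(`exists_bch_columns`). -/

/-! ### Scalars with prescribed power sums -/

/-- Finitely many complex numbers whose power sums of degrees `1, …, d` all vanish, except for
the power sum of degree `2`, which is `1`. -/
theorem exists_sum_pow_eq_ite (d : ℕ) (hd : 2 ≤ d) :
    ∃ (K : ℕ) (c : Fin K → ℂ), ∀ j, 1 ≤ j → j ≤ d → ∑ k, c k ^ j = if j = 2 then 1 else 0 := by
  induction d, hd using Nat.le_induction with
  | base =>
    obtain ⟨z, hz⟩ := IsAlgClosed.exists_pow_nat_eq (1 / 2 : ℂ) (n := 2) (by norm_num)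
    refine ⟨2, ![z, -z], fun j h1 h2 => ?_⟩
    interval_cases j
    · simp
    · simp [hz]; norm_num
  | succ d hd ih =>
    obtain ⟨K, c, hc⟩ := ih
    have hd0 : ((d + 1 : ℕ) : ℂ) ≠ 0 := by exact_mod_cast Nat.succ_ne_zero d
    -- Adjoining `α` times all `(d+1)`-th roots of unity leaves the power sums of degrees `1, …, d`
    -- alone and adds `(d+1) α^(d+1)` in degree `d+1`.
    obtain ⟨α, hα⟩ := IsAlgClosed.exists_pow_nat_eq (-(∑ k, c k ^ (d + 1)) / ((d + 1 : ℕ) : ℂ))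
      (n := d + 1) (by lia)
    have hζ := Complex.isPrimitiveRoot_exp (d + 1) (by lia)
    set ζ := Complex.exp (2 * Real.pi * Complex.I / ((d + 1 : ℕ) : ℂ)) with hζdef
    refine ⟨K + (d + 1), Fin.append c (fun i => α * ζ ^ (i : ℕ)), fun j h1 h2 => ?_⟩
    have hsum : ∑ k, (Fin.append c (fun i : Fin (d + 1) => α * ζ ^ (i : ℕ))) k ^ j
        = ∑ k, c k ^ j + α ^ j * ∑ i ∈ Finset.range (d + 1), (ζ ^ j) ^ i := by
      rw [Fin.sum_univ_add, Finset.sum_range, Finset.mul_sum]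
      congr 1
      · simp
      · refine Finset.sum_congr rfl fun i _ => ?_
        rw [Fin.append_right, mul_pow, ← pow_mul, ← pow_mul, mul_comm j]
    rw [hsum]
    rcases Nat.lt_or_ge j (d + 1) with hj | hj
    · have hne : ζ ^ j ≠ 1 := hζ.pow_ne_one_of_pos_of_lt (by lia) hj
      have hgeom : ∑ i ∈ Finset.range (d + 1), (ζ ^ j) ^ i = 0 := by
        have h := geom_sum_mul (ζ ^ j) (d + 1)
        rw [← pow_mul, mul_comm j, pow_mul, hζ.pow_eq_one, one_pow, sub_self] at h
        exact (mul_eq_zero.mp h).resolve_right (sub_ne_zero.mpr hne)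
      rw [hgeom, mul_zero, add_zero, hc j h1 (by lia)]
    · obtain rfl : j = d + 1 := by lia
      rw [hζ.pow_eq_one, hα, if_neg (by lia)]
      simp only [one_pow, Finset.sum_const, Finset.card_range, nsmul_eq_mul, mul_one]
      rw [div_mul_cancel₀ _ hd0, add_neg_cancel]

/-! ### Moments of random signs via generating functions -/

section Hypercube

open PowerSeries

theorem derivative_rescale {R : Type*} [CommSemiring R] (a : R) (f : PowerSeries R) :
    d⁄dX R (rescale a f) = C a * rescale a (d⁄dX R f) := by
  ext n
  simp only [coeff_derivative, coeff_rescale, coeff_C_mul, pow_succ]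
  ring

theorem derivative_prod_of_logDeriv {R ι : Type*} [CommSemiring R] (S : Finset ι)
    (h g : ι → PowerSeries R) (hg : ∀ j ∈ S, d⁄dX R (h j) = h j * g j) :
    d⁄dX R (∏ j ∈ S, h j) = (∏ j ∈ S, h j) * ∑ j ∈ S, g j := by
  classical
  induction S using Finset.induction_on with
  | empty => simp
  | insert a S ha ih =>
    rw [Finset.prod_insert ha, Finset.sum_insert ha, Derivation.leibniz,
      ih fun j hj => hg j (Finset.mem_insert_of_mem hj), hg a (Finset.mem_insert_self _ _)]
    simp only [smul_eq_mul]
    ring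

/-- `T` is the series of tanh. In the logarithmic derivative of `∏ 2 cosh (y_i t)`, its coefficient
of degree `r` multiplies the power sum of degree `r + 1`. -/
theorem exists_logDeriv_two_cosh :
    ∃ T : PowerSeries ℂ, coeff 1 T = 1 ∧
      d⁄dX ℂ (exp ℂ + rescale (-1) (exp ℂ)) = (exp ℂ + rescale (-1) (exp ℂ)) * T := by
  set H := exp ℂ + rescale (-1 : ℂ) (exp ℂ) with hH
  have h0 : constantCoeff H = 2 := by
    rw [← coeff_zero_eq_constantCoeff_apply, hH, map_add, coeff_rescale]
    simp [coeff_exp]; norm_num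
  have h1 : coeff 1 H = 0 := by simp [hH, coeff_rescale, coeff_exp]
  have h2 : coeff 2 H = 1 := by simp [hH, coeff_rescale, coeff_exp, Nat.factorial]; norm_num
  have hT : d⁄dX ℂ H = H * (H⁻¹ * d⁄dX ℂ H) := by
    rw [← mul_assoc, PowerSeries.mul_inv_cancel _ (by rw [h0]; norm_num), one_mul]
  refine ⟨H⁻¹ * d⁄dX ℂ H, ?_, hT⟩
  have h := congrArg (coeff 1) hT
  rw [coeff_derivative, coeff_mul, Finset.Nat.antidiagonal_succ] at h
  simp [h0, h1, h2] at h
  norm_num at h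
  exact h

/-- Moments of a sum of independent signs with complex weights `y`: if the power sums of `y` of
degrees `1, …, 2 * s` vanish, except possibly the one of degree `2`, then the moment of order
`2 * s` is the one of a Gaussian. -/
theorem sum_signs_pow {ι : Type*} [Fintype ι] [DecidableEq ι] (s : ℕ) (y : ι → ℂ)
    (hy : ∀ j, 1 ≤ j → j ≤ 2 * s → j ≠ 2 → ∑ i, y i ^ j = 0) :
    ∑ ε : ι → ℤˣ, (∑ i, ((ε i : ℤ) : ℂ) * y i) ^ (2 * s) =
      2 ^ Fintype.card ι * (((2 * s).factorial : ℂ) / (2 ^ s * s.factorial)) *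
        (∑ i, y i ^ 2) ^ s := by
  obtain ⟨T, hT1, hT⟩ := exists_logDeriv_two_cosh
  set H := exp ℂ + rescale (-1 : ℂ) (exp ℂ) with hH
  set M := ∏ i, rescale (y i) H with hM
  have hexp : M = ∑ ε : ι → ℤˣ, rescale (∑ i, ((ε i : ℤ) : ℂ) * y i) (exp ℂ) := by
    have hfac : ∀ i, rescale (y i) H
        = ∑ e : ℤˣ, rescale (((e : ℤ) : ℂ) * y i) (exp ℂ) := by
      intro i
      rw [show (Finset.univ : Finset ℤˣ) = {1, -1} from rfl, Finset.sum_pair (by decide), hH,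
        map_add, rescale_rescale]
      simp
    have hprod : ∀ (S : Finset ι) (a : ι → ℂ),
        ∏ i ∈ S, rescale (a i) (exp ℂ) = rescale (∑ i ∈ S, a i) (exp ℂ) := by
      intro S a
      induction S using Finset.induction_on with
      | empty => simp
      | insert i S hi ih =>
        rw [Finset.prod_insert hi, Finset.sum_insert hi, ih, exp_mul_exp_eq_exp_add]
    rw [hM, Finset.prod_congr rfl fun i _ => hfac i, Finset.prod_univ_sum]
    simp only [Fintype.piFinset_univ, hprod]
  have hder : d⁄dX ℂ M = M * ∑ i, C (y i) * rescale (y i) T := by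
    refine derivative_prod_of_logDeriv _ _ _ fun i _ => ?_
    rw [derivative_rescale, hT, map_mul]
    ring
  have hG : ∀ r, r < 2 * s → coeff r (∑ i, C (y i) * rescale (y i) T)
      = if r = 1 then ∑ i, y i ^ 2 else 0 := by
    intro r hr
    have h : coeff r (∑ i, C (y i) * rescale (y i) T) = coeff r T * ∑ i, y i ^ (r + 1) := by
      rw [map_sum, Finset.mul_sum]
      refine Finset.sum_congr rfl fun i _ => ?_
      rw [coeff_C_mul, coeff_rescale, pow_succ]
      ring
    rw [h]
    split_ifs with h1
    · rw [h1, hT1, one_mul]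
    · rw [hy (r + 1) (by lia) (by lia) (by lia), mul_zero]
  -- Below degree `2s` the logarithmic derivative is just `p₂ t`, where `p₂ = ∑ y_i^2`, so `M` obeys
  -- the recursion of `exp (p₂ t² / 2)`.
  have hrec : ∀ k, k + 1 < 2 * s →
      coeff (k + 2) M * ((k : ℂ) + 2) = coeff k M * ∑ i, y i ^ 2 := by
    intro k hk
    have h := congrArg (coeff (k + 1)) hder
    rw [coeff_derivative, coeff_mul, Finset.sum_eq_single (k, 1)] at h
    · rw [hG 1 (by lia), if_pos rfl] at h
      rw [← h]
      push_cast
      ring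
    · rintro ⟨a, b⟩ hab hne
      have hab' : a + b = k + 1 := Finset.HasAntidiagonal.mem_antidiagonal.mp hab
      rw [hG b (by lia), if_neg, mul_zero]
      rintro rfl
      exact hne (by rw [Prod.mk.injEq]; lia)
    · intro h'
      exact absurd (Finset.HasAntidiagonal.mem_antidiagonal.mpr (by rfl)) h'
  have h0 : coeff 0 M = 2 ^ Fintype.card ι := by
    rw [hexp, map_sum]
    simp [coeff_rescale, Fintype.card_pi]
  have hM' : ∀ r, r ≤ s → coeff (2 * r) M =
      2 ^ Fintype.card ι * (∑ i, y i ^ 2) ^ r / (2 ^ r * r.factorial) := by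
    intro r
    induction r with
    | zero => intro _; simp [h0]
    | succ r ih =>
      intro hr
      have h := hrec (2 * r) (by lia)
      rw [ih (by lia)] at h
      have hr1 : ((r : ℂ) + 1) ≠ 0 := by exact_mod_cast Nat.succ_ne_zero r
      have hr2 : ((2 * r : ℕ) : ℂ) + 2 ≠ 0 := by exact_mod_cast Nat.succ_ne_zero (2 * r + 1)
      have hf : (r.factorial : ℂ) ≠ 0 := by exact_mod_cast r.factorial_ne_zero
      rw [show 2 * (r + 1) = 2 * r + 2 by ring, eq_div_of_mul_eq hr2 h, Nat.factorial_succ]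
      push_cast at hr2 ⊢
      field_simp
      ring
  have hs := hM' s le_rfl
  have hf : ((2 * s).factorial : ℂ) ≠ 0 := by exact_mod_cast (2 * s).factorial_ne_zero
  have hcoeff : coeff (2 * s) M =
      (∑ ε : ι → ℤˣ, (∑ i, ((ε i : ℤ) : ℂ) * y i) ^ (2 * s)) / (2 * s).factorial := by
    rw [hexp, map_sum, Finset.sum_div]
    refine Finset.sum_congr rfl fun ε _ => ?_
    simp [coeff_rescale, coeff_exp, div_eq_mul_inv]
  rw [hcoeff, div_eq_iff hf] at hs
  rw [hs]
  ring

end Hypercube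

/-! ### Binary BCH codes -/

/-- A sum in characteristic two only sees the parities of the multiplicities. -/
theorem sum_comp_eq_sum_filter_odd {ι κ M : Type*} [Fintype ι] [DecidableEq ι] [Fintype κ]
    [AddCommMonoid M] (h2 : ∀ x : M, 2 • x = 0) (w : κ → ι) (u : ι → M) :
    ∑ i, u (w i) =
      ∑ j with Odd (Finset.univ.filter fun i => w i = j).card, u j := by
  rw [← Finset.sum_fiberwise' Finset.univ w u, Finset.sum_filter]
  refine Finset.sum_congr rfl fun j _ => ?_
  rw [Finset.sum_const]
  split_ifs with h
  · obtain ⟨k, hk⟩ := h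
    rw [hk, add_nsmul, mul_comm, mul_nsmul, h2, one_nsmul, zero_add]
  · obtain ⟨k, hk⟩ := Nat.not_odd_iff_even.mp h
    rw [hk, ← two_mul, mul_comm, mul_nsmul, h2]

/-- In characteristic two, the power sums of odd degree less than `2 * s` determine
those of positive degree less than `2 * s`. -/
theorem sum_pow_eq_zero_of_odd {F κ : Type*} [CommRing F] [CharP F 2] [Fintype κ] (s : ℕ)
    (x : κ → F) (hx : ∀ k, k < s → ∑ i, x i ^ (2 * k + 1) = 0) (r : ℕ) (hr0 : 0 < r)
    (hr : r < 2 * s) : ∑ i, x i ^ r = 0 := by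
  induction r using Nat.strong_induction_on with
  | _ r ih =>
    rcases Nat.even_or_odd' r with ⟨k, rfl | rfl⟩
    · simp_rw [mul_comm 2 k, pow_mul]
      -- Frobenius: the power sum of degree `2k` is the square of that of degree `k`.
      rw [← sum_pow_char 2 Finset.univ fun i => x i ^ k, ih k (by lia) (by lia) (by lia)]
      exact zero_pow two_ne_zero
    · exact hx k (by lia)

/-- The columns of the parity check matrix of a binary BCH code: a word of length `2 * s` in the
columns sums to zero only if every column occurs in it an even number of times. -/
theorem exists_bch_columns (ι : Type*) [Fintype ι] [DecidableEq ι] [Nonempty ι] (s : ℕ) :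
    ∃ (V : Type) (_ : AddCommGroup V) (_ : Fintype V) (v : ι → V),
      Fintype.card V ≤ (2 * Fintype.card ι) ^ s ∧
      ∀ w : Fin (2 * s) → ι, ∑ i, v (w i) = 0 ↔
        ∀ j, Even (Finset.univ.filter fun i => w i = j).card := by
  classical
  set m := Nat.log 2 (Fintype.card ι) + 1 with hm
  have hm1 : Fintype.card ι ≤ 2 ^ m := (Nat.lt_pow_succ_log_self one_lt_two _).le
  have hm2 : 2 ^ m ≤ 2 * Fintype.card ι := by
    rw [hm, pow_succ, mul_comm]
    exact Nat.mul_le_mul_left 2 (Nat.pow_log_le_self 2 Fintype.card_ne_zero)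
  have : Fact (Nat.Prime 2) := ⟨Nat.prime_two⟩
  let F := GaloisField 2 m
  have : Fintype F := Fintype.ofFinite F
  have hF : Fintype.card F = 2 ^ m := by
    rw [Fintype.card_eq_nat_card]
    exact GaloisField.card 2 m (Nat.succ_ne_zero _)
  obtain ⟨a⟩ : Nonempty (ι ↪ F) := Function.Embedding.nonempty_of_card_le (hm1.trans_eq hF.symm)
  have h2 : ∀ x : F, 2 • x = 0 := fun x => by
    rw [two_nsmul]
    exact CharTwo.add_self_eq_zero x
  refine ⟨Fin s → F, inferInstance, inferInstance, fun j k => a j ^ (2 * (k : ℕ) + 1), ?_,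
    fun w => ⟨fun h => ?_, fun h => ?_⟩⟩
  · rw [Fintype.card_fun, Fintype.card_fin, hF]
    exact Nat.pow_le_pow_left hm2 s
  · set J := Finset.univ.filter fun j => Odd (Finset.univ.filter fun i => w i = j).card with hJ
    have hJcard : J.card ≤ 2 * s := by
      calc J.card ≤ (Finset.univ.image w).card := by
            refine Finset.card_le_card fun j hj => ?_
            have hodd := (Finset.mem_filter.mp hj).2
            obtain ⟨i, hi⟩ := Finset.card_pos.mp hodd.pos
            exact Finset.mem_image.mpr ⟨i, Finset.mem_univ _, (Finset.mem_filter.mp hi).2⟩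
        _ ≤ 2 * s := Finset.card_image_le.trans_eq (by simp)
    have hpow : ∀ r, r < 2 * s → ∑ j ∈ J, a j ^ r = 0 := by
      intro r hr
      rw [hJ, ← sum_comp_eq_sum_filter_odd h2 w fun j => a j ^ r]
      rcases Nat.eq_zero_or_pos r with rfl | hr0
      · simp only [pow_zero, Finset.sum_const, Finset.card_univ, Fintype.card_fin]
        rw [mul_comm, mul_nsmul, h2]
      · refine sum_pow_eq_zero_of_odd s (fun i => a (w i)) (fun k hk => ?_) r hr0 hr
        simpa using congrFun h ⟨k, hk⟩
    -- Vandermonde: at most `2s` distinct points whose power sums of degrees `0, …, 2s - 1` all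
    -- vanish must form the empty set.
    have hv := Matrix.eq_zero_of_forall_pow_sum_mul_pow_eq_zero
      (f := fun i : Fin J.card => a (J.equivFin.symm i)) (v := fun _ => (1 : F))
      (a.injective.comp (Subtype.val_injective.comp (Equiv.injective _))) fun r => by
        simp_rw [one_mul]
        rw [Equiv.sum_comp J.equivFin.symm (fun j : J => a j ^ (r : ℕ)),
          Finset.sum_coe_sort J fun j => a j ^ (r : ℕ)]
        exact hpow r (r.2.trans_le hJcard)
    have hJ0 : J.card = 0 := by
      by_contra hne
      exact one_ne_zero (congrFun hv ⟨0, Nat.pos_of_ne_zero hne⟩)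
    intro j
    by_contra hj
    have hmem : j ∈ J := Finset.mem_filter.mpr ⟨Finset.mem_univ _, Nat.not_even_iff_odd.mp hj⟩
    simp [Finset.card_eq_zero.mp hJ0] at hmem
  · ext k
    rw [Finset.sum_apply, sum_comp_eq_sum_filter_odd h2 w fun j => a j ^ (2 * (k : ℕ) + 1)]
    rw [Finset.filter_false_of_mem fun j _ => Nat.not_odd_iff_even.mpr (h j)]
    simp

/-! ### Character sums and sign sums as sums over words -/

theorem sum_addChar_pow {ι V : Type*} [Fintype ι] [AddCommGroup V] [Fintype V] [DecidableEq V]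
    (v : ι → V) (y : ι → ℂ) (m : ℕ) :
    ∑ ψ : AddChar V ℂ, (∑ j, ψ (v j) * y j) ^ m =
      Fintype.card V * ∑ w : Fin m → ι, if ∑ i, v (w i) = 0 then ∏ i, y (w i) else 0 := by
  simp_rw [Fintype.sum_pow, Finset.prod_mul_distrib]
  rw [Finset.sum_comm, Finset.mul_sum]
  refine Finset.sum_congr rfl fun w _ => ?_
  have h : ∀ ψ : AddChar V ℂ, ∏ i, ψ (v (w i)) = ψ (∑ i, v (w i)) := fun ψ =>
    (map_prod ψ.toMonoidHom (fun i => Multiplicative.ofAdd (v (w i))) _).symm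
  simp_rw [h]
  rw [← Finset.sum_mul, AddChar.sum_apply_eq_ite]
  split_ifs <;> simp

/-- Summing over the sign at `j` kills odd multiplicities of `j`. For BCH columns the surviving
words are those of `sum_addChar_pow`, which lets characters replace signs. -/
theorem sum_signs_pow_eq_sum_words {ι : Type*} [Fintype ι] [DecidableEq ι] (y : ι → ℂ) (m : ℕ) :
    ∑ ε : ι → ℤˣ, (∑ j, ((ε j : ℤ) : ℂ) * y j) ^ m =
      2 ^ Fintype.card ι * ∑ w : Fin m → ι,
        if ∀ j, Even (Finset.univ.filter fun i => w i = j).card then ∏ i, y (w i) else 0 := by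
  simp_rw [Fintype.sum_pow, Finset.prod_mul_distrib]
  rw [Finset.sum_comm, Finset.mul_sum]
  refine Finset.sum_congr rfl fun w _ => ?_
  rw [← Finset.sum_mul]
  have h1 : ∀ ε : ι → ℤˣ, ∏ i, (((ε (w i) : ℤˣ) : ℤ) : ℂ)
      = ∏ j, (((ε j : ℤ) : ℂ) ^ (Finset.univ.filter fun i => w i = j).card) := by
    intro ε
    rw [← Finset.prod_fiberwise' Finset.univ w fun j => ((ε j : ℤ) : ℂ)]
    simp_rw [Finset.prod_const]
  have h2 : ∀ k : ℕ, ∑ e : ℤˣ, (((e : ℤ) : ℂ) ^ k) = if Even k then 2 else 0 := by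
    intro k
    rw [show (Finset.univ : Finset ℤˣ) = {1, -1} from rfl, Finset.sum_pair (by decide)]
    rcases Nat.even_or_odd k with hk | hk
    · rw [if_pos hk]; simp [hk.neg_one_pow]; norm_num
    · rw [if_neg (Nat.not_even_iff_odd.mpr hk)]; simp [hk.neg_one_pow]
  have h3 := Finset.prod_univ_sum (fun _ : ι => (Finset.univ : Finset ℤˣ))
    fun j e => (((e : ℤ) : ℂ) ^ (Finset.univ.filter fun i => w i = j).card)
  rw [Fintype.piFinset_univ] at h3
  simp_rw [h1]
  rw [← h3]
  simp_rw [h2]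
  split_ifs with h
  · rw [Finset.prod_congr rfl fun j _ => if_pos (h j)]
    simp
  · push Not at h
    obtain ⟨j, hj⟩ := h
    rw [Finset.prod_eq_zero (Finset.mem_univ j) (if_neg hj)]
    simp

/-! ### Lower bound by catalecticants -/

/-- The exponent vector of the squarefree monomial with support `A`. -/
noncomputable def squarefreeExponent {σ : Type*} [Fintype σ] [DecidableEq σ] (A : Finset σ) :
    σ →₀ ℕ :=
  Finsupp.equivFunOnFinite.symm fun i => if i ∈ A then 1 else 0

theorem squarefreeExponent_apply {σ : Type*} [Fintype σ] [DecidableEq σ] (A : Finset σ) (i : σ) :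
    squarefreeExponent A i = if i ∈ A then 1 else 0 := rfl

theorem degree_squarefreeExponent {σ : Type*} [Fintype σ] [DecidableEq σ] (A : Finset σ) :
    (squarefreeExponent A).degree = A.card := by
  simp [Finsupp.degree_eq_sum, squarefreeExponent_apply]

theorem degree_squarefreeExponent_add {n s : ℕ} (A B : {A : Finset (Fin n) // A.card = s}) :
    (squarefreeExponent A.1 + squarefreeExponent B.1).degree = 2 * s := by
  rw [map_add, degree_squarefreeExponent, degree_squarefreeExponent, A.2, B.2, two_mul]

/-- The principal submatrix of the middle catalecticant of a form of degree `2 * s` that belongs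
to the squarefree monomials. -/
noncomputable def squarefreeCatalecticant {n : ℕ} (s : ℕ) (f : MvPolynomial (Fin n) ℂ) :
    Matrix {A : Finset (Fin n) // A.card = s} {A : Finset (Fin n) // A.card = s} ℂ :=
  fun A B => ((squarefreeExponent A.1 + squarefreeExponent B.1).multinomial : ℂ)⁻¹ *
    f.coeff (squarefreeExponent A.1 + squarefreeExponent B.1)

theorem Finsupp.multinomial_ne_zero {σ : Type*} (m : σ →₀ ℕ) : m.multinomial ≠ 0 :=
  (Nat.multinomial_pos _ _).ne'

theorem MvPolynomial.IsHomogeneous.exists_eq_sum_smul_X {n : ℕ} {l : MvPolynomial (Fin n) ℂ}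
    (hl : l.IsHomogeneous 1) : ∃ a : Fin n → ℂ, l = ∑ i, a i • MvPolynomial.X i := by
  have h : l ∈ MvPolynomial.homogeneousSubmodule (Fin n) ℂ 1 := hl
  rw [MvPolynomial.homogeneousSubmodule_one_eq_span_X,
    Submodule.mem_span_range_iff_exists_fun] at h
  obtain ⟨a, ha⟩ := h
  exact ⟨a, ha.symm⟩

/-- After division by the multinomial coefficient, each power `l^(2s)` contributes the rank-one
matrix `u uᵀ` with `u_A = ∏_{i ∈ A} a_i`. -/
theorem rank_squarefreeCatalecticant_le {n s k : ℕ} {f : MvPolynomial (Fin n) ℂ}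
    (hf : HasWaringDecomposition (2 * s) f k) : (squarefreeCatalecticant s f).rank ≤ k := by
  obtain ⟨l, -, hl, rfl⟩ := hf
  choose a ha using fun j => (hl j).exists_eq_sum_smul_X
  let U : Matrix {A : Finset (Fin n) // A.card = s} (Fin k) ℂ := fun A j => ∏ i ∈ A.1, a j i
  have hU : squarefreeCatalecticant s (∑ j, l j ^ (2 * s)) = U * U.transpose := by
    ext A B
    have hm : ((squarefreeExponent A.1 + squarefreeExponent B.1).multinomial : ℂ) ≠ 0 :=
      Nat.cast_ne_zero.mpr (Finsupp.multinomial_ne_zero _)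
    have hdeg : (squarefreeExponent A.1 + squarefreeExponent B.1).sum (fun _ m => m) = 2 * s :=
      degree_squarefreeExponent_add A B
    rw [squarefreeCatalecticant, MvPolynomial.coeff_sum, Finset.mul_sum, Matrix.mul_apply]
    refine Finset.sum_congr rfl fun j _ => ?_
    rw [ha j, MvPolynomial.coeff_linearCombination_X_pow_of_fintype, if_pos hdeg,
      inv_mul_cancel_left₀ hm, Finsupp.prod_fintype _ _ fun i => pow_zero _]
    have hprod : ∀ C : {A : Finset (Fin n) // A.card = s},
        ∏ i, a j i ^ squarefreeExponent C.1 i = U C j := by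
      intro C
      simp [U, squarefreeExponent_apply]
    simp_rw [Finsupp.add_apply, pow_add]
    rw [Finset.prod_mul_distrib, hprod, hprod, Matrix.transpose_apply]
  rw [hU]
  exact (Matrix.rank_mul_le_left _ _).trans (by simpa using Matrix.rank_le_card_width U)

theorem quadForm_eq_expand (n : ℕ) :
    quadForm n = MvPolynomial.expand 2 (∑ i, MvPolynomial.X i) := by
  simp [quadForm]

theorem isHomogeneous_quadForm_pow (n s : ℕ) : (quadForm n ^ s).IsHomogeneous (2 * s) :=
  (MvPolynomial.IsHomogeneous.sum _ _ _ fun i _ => MvPolynomial.isHomogeneous_X_pow i 2).pow s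

/-- Only even exponents occur in `q_n^s`, and a product of two squarefree monomials has even
exponents only if they coincide. -/
theorem squarefreeCatalecticant_quadForm_pow (n s : ℕ) :
    ∃ d : {A : Finset (Fin n) // A.card = s} → ℂ, (∀ A, d A ≠ 0) ∧
      squarefreeCatalecticant s (quadForm n ^ s) = Matrix.diagonal d := by
  refine ⟨fun A => squarefreeCatalecticant s (quadForm n ^ s) A A, fun A => ?_, ?_⟩
  · change squarefreeCatalecticant s (quadForm n ^ s) A A ≠ 0
    have hdeg : (squarefreeExponent A.1).sum (fun _ m => m) = s :=
      (degree_squarefreeExponent A.1).trans A.2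
    rw [squarefreeCatalecticant, quadForm_eq_expand, ← map_pow, ← two_nsmul,
      MvPolynomial.coeff_expand_smul 2 two_ne_zero, MvPolynomial.coeff_sum_X_pow_of_fintype,
      if_pos hdeg]
    exact mul_ne_zero (inv_ne_zero (Nat.cast_ne_zero.mpr (Finsupp.multinomial_ne_zero _)))
      (Nat.cast_ne_zero.mpr (Finsupp.multinomial_ne_zero _))
  · ext A B
    rcases eq_or_ne A B with rfl | h
    · rw [Matrix.diagonal_apply_eq]
    · rw [Matrix.diagonal_apply_ne _ h, squarefreeCatalecticant, quadForm_eq_expand, ← map_pow]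
      obtain ⟨i, hi⟩ : ∃ i, ¬ (i ∈ A.1 ↔ i ∈ B.1) := by
        by_contra! hcon
        exact h (Subtype.ext (Finset.ext hcon))
      rw [MvPolynomial.coeff_expand_of_not_dvd (i := i), mul_zero]
      rw [Finsupp.add_apply, squarefreeExponent_apply, squarefreeExponent_apply]
      by_cases hA : i ∈ A.1 <;> by_cases hB : i ∈ B.1 <;> simp_all

theorem choose_le_of_mem_zariskiClosure {n s r : ℕ}
    (h : quadForm n ^ s ∈ zariskiClosure (2 * s) (formsOfRankLE n (2 * s) r)) :
    n.choose s ≤ r := by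
  by_contra! hr
  let N : Matrix {A : Finset (Fin n) // A.card = s} {A : Finset (Fin n) // A.card = s}
      (MvPolynomial {m : Fin n →₀ ℕ // m.degree = 2 * s} ℂ) := fun A B =>
    MvPolynomial.C ((squarefreeExponent A.1 + squarefreeExponent B.1).multinomial : ℂ)⁻¹ *
      MvPolynomial.X ⟨_, degree_squarefreeExponent_add A B⟩
  have hN : ∀ f : MvPolynomial (Fin n) ℂ, MvPolynomial.eval (formCoords (2 * s) f) N.det =
      (squarefreeCatalecticant s f).det := by
    intro f
    rw [RingHom.map_det]
    congr 1
    ext A B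
    rw [RingHom.mapMatrix_apply, Matrix.map_apply]
    simp [N, squarefreeCatalecticant, formCoords]
  have hzero := h.2 N.det fun g hg => by
    obtain ⟨k, hk, hg⟩ := hg
    rw [hN]
    by_contra hdet
    have hrank := Matrix.rank_of_isUnit (squarefreeCatalecticant s g)
      ((Matrix.isUnit_iff_isUnit_det _).mpr (isUnit_iff_ne_zero.mpr hdet))
    rw [Fintype.card_finset_len, Fintype.card_fin] at hrank
    have := rank_squarefreeCatalecticant_le hg
    lia
  obtain ⟨d, hd, hdiag⟩ := squarefreeCatalecticant_quadForm_pow n s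
  rw [hN, hdiag, Matrix.det_diagonal] at hzero
  exact Finset.prod_ne_zero_iff.mpr (fun A _ => hd A) hzero

/-- The decomposition makes the set under `sInf` nonempty; otherwise the infimum would default to
`0`. -/
theorem choose_le_borderRank {n s k : ℕ}
    (h : HasWaringDecomposition (2 * s) (quadForm n ^ s) k) :
    n.choose s ≤ borderRank (2 * s) (quadForm n ^ s) := by
  refine choose_le_of_mem_zariskiClosure (Nat.sInf_mem
    (s := {r | quadForm n ^ s ∈ zariskiClosure (2 * s) (formsOfRankLE n (2 * s) r)}) ⟨k, ?_⟩)
  exact ⟨isHomogeneous_quadForm_pow n s, fun P hP => hP _ ⟨k, le_rfl, h⟩⟩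

theorem borderRank_le_waringRank {n d k : ℕ} {f : MvPolynomial (Fin n) ℂ}
    (hf : f.IsHomogeneous d) (h : HasWaringDecomposition d f k) :
    borderRank d f ≤ waringRank d f :=
  Nat.sInf_le ⟨hf, fun _ hP => hP _
    ⟨waringRank d f, le_rfl, Nat.sInf_mem (s := {r | HasWaringDecomposition d f r}) ⟨k, h⟩⟩⟩

/-! ### Upper bound by an explicit decomposition -/

/-- Equal forms in a sum of `d`-th powers can be merged, as `ℂ` contains `d`-th roots. -/
theorem exists_hasWaringDecomposition_le_card {n d : ℕ} (hd : d ≠ 0)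
    (S : Multiset (MvPolynomial (Fin n) ℂ)) (hS : ∀ l ∈ S, l.IsHomogeneous 1) :
    ∃ k ≤ S.card, HasWaringDecomposition d (S.map (· ^ d)).sum k := by
  classical
  induction hc : S.card using Nat.strong_induction_on generalizing S with
  | _ c ih =>
    by_cases hnd : S.Nodup
    · refine ⟨c, le_rfl, fun j => (S.toFinset.equivFinOfCardEq ?_).symm j, ?_, fun j => ?_, ?_⟩
      · rw [Multiset.toFinset_card_of_nodup hnd, hc]
      · exact Subtype.val_injective.comp (Equiv.injective _)
      · exact hS _ (Multiset.mem_toFinset.mp (Subtype.prop _))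
      · rw [Equiv.sum_comp (Finset.equivFinOfCardEq _).symm
          (fun l : S.toFinset => (l : MvPolynomial (Fin n) ℂ) ^ d),
          Finset.sum_coe_sort S.toFinset fun l => l ^ d, Finset.sum, Multiset.toFinset_val,
          hnd.dedup]
    · rw [Multiset.nodup_iff_ne_cons_cons] at hnd
      push Not at hnd
      obtain ⟨l, S, rfl⟩ := hnd
      obtain ⟨z, hz⟩ := IsAlgClosed.exists_pow_nat_eq (2 : ℂ) (Nat.pos_of_ne_zero hd)
      obtain ⟨k, hk, hdec⟩ := ih (MvPolynomial.C z * l ::ₘ S).card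
        (by rw [← hc]; simp) (MvPolynomial.C z * l ::ₘ S) (fun p hp => by
          rcases Multiset.mem_cons.mp hp with rfl | hp
          · simpa using (MvPolynomial.isHomogeneous_C (Fin n) z).mul (hS l (by simp))
          · exact hS p (by simp [hp])) rfl
      refine ⟨k, hk.trans (by rw [← hc]; simp), ?_⟩
      convert hdec using 1
      simp only [Multiset.map_cons, Multiset.sum_cons, mul_pow, ← map_pow, hz, map_ofNat]
      ring

theorem sum_addChar_pow_eq {n s K : ℕ} {V : Type} [AddCommGroup V] [Fintype V] (c : Fin K → ℂ)
    (hc : ∀ j, 1 ≤ j → j ≤ 2 * s → ∑ k, c k ^ j = if j = 2 then 1 else 0)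
    (hs : 1 ≤ s) (v : Fin n × Fin K → V)
    (hv : ∀ w : Fin (2 * s) → Fin n × Fin K, ∑ i, v (w i) = 0 ↔
        ∀ j, Even (Finset.univ.filter fun i => w i = j).card) :
    ∑ ψ : AddChar V ℂ, (∑ i, (∑ k, ψ (v (i, k)) * c k) • MvPolynomial.X i) ^ (2 * s) =
      MvPolynomial.C (Fintype.card V * ((2 * s).factorial / (2 ^ s * s.factorial)) : ℂ) *
        quadForm n ^ s := by
  classical
  refine MvPolynomial.funext fun x => ?_
  let y : Fin n × Fin K → ℂ := fun p => c p.2 * x p.1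
  have hy : ∀ j, ∑ p, y p ^ j = (∑ k, c k ^ j) * ∑ i, x i ^ j := by
    intro j
    rw [Fintype.sum_prod_type, Finset.sum_mul_sum, Finset.sum_comm]
    simp_rw [y, mul_pow]
  have h1 := sum_signs_pow s y fun j hj1 hj2 hj => by
    rw [hy, hc j hj1 hj2, if_neg hj, zero_mul]
  rw [sum_signs_pow_eq_sum_words, mul_assoc] at h1
  -- Cancelling the number of sign patterns leaves the sum over even words, free of any reference to
  -- signs.
  have h2 := mul_left_cancel₀ (pow_ne_zero _ two_ne_zero) h1
  simp_rw [← hv] at h2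
  have h3 := sum_addChar_pow v y (2 * s)
  rw [h2, hy, hc 2 (by lia) (by lia), if_pos rfl, one_mul, ← mul_assoc] at h3
  simp only [map_sum, map_pow, map_mul, MvPolynomial.smul_eval, MvPolynomial.eval_X,
    MvPolynomial.eval_C, quadForm]
  rw [← h3]
  refine Finset.sum_congr rfl fun ψ _ => ?_
  rw [Fintype.sum_prod_type]
  simp_rw [y, Finset.sum_mul, mul_assoc]

theorem exists_hasWaringDecomposition_quadForm_pow (s : ℕ) :
    ∃ C : ℕ, 0 < C ∧ ∀ n, 1 ≤ n →
      ∃ k ≤ C * n ^ s, HasWaringDecomposition (2 * s) (quadForm n ^ s) k := by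
  rcases Nat.eq_zero_or_pos s with rfl | hs
  -- In degree `0` the single zero form works, since `0 ^ 0 = 1`.
  · refine ⟨1, one_pos, fun n _ => ⟨1, by simp, fun _ => 0, Function.injective_of_subsingleton _,
      fun _ => MvPolynomial.isHomogeneous_zero _ _ _, by simp⟩⟩
  · obtain ⟨K, c, hc⟩ := exists_sum_pow_eq_ite (2 * s) (by lia)
    have hK : 0 < K := by
      rcases Nat.eq_zero_or_pos K with rfl | hK
      · simpa using hc 2 (by lia) (by lia)
      · exact hK
    refine ⟨(2 * K) ^ s, by positivity, fun n hn => ?_⟩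
    have : Nonempty (Fin n × Fin K) := ⟨(⟨0, hn⟩, ⟨0, hK⟩)⟩
    obtain ⟨V, _, _, v, hV, hv⟩ := exists_bch_columns (Fin n × Fin K) s
    have hsum := sum_addChar_pow_eq c hc hs v hv
    set κ : ℂ := Fintype.card V * ((2 * s).factorial / (2 ^ s * s.factorial)) with hκ
    have hκ0 : κ ≠ 0 := by
      have h1 : (Fintype.card V : ℂ) ≠ 0 := Nat.cast_ne_zero.mpr Fintype.card_ne_zero
      have h2 : ((2 * s).factorial : ℂ) ≠ 0 := Nat.cast_ne_zero.mpr (Nat.factorial_ne_zero _)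
      have h3 : (s.factorial : ℂ) ≠ 0 := Nat.cast_ne_zero.mpr (Nat.factorial_ne_zero _)
      exact mul_ne_zero h1 (div_ne_zero h2 (mul_ne_zero (pow_ne_zero _ two_ne_zero) h3))
    -- Scaling every linear form by `z` absorbs the constant `κ`.
    obtain ⟨z, hz⟩ := IsAlgClosed.exists_pow_nat_eq κ⁻¹ (n := 2 * s) (by lia)
    obtain ⟨k, hk, hdec⟩ := exists_hasWaringDecomposition_le_card (d := 2 * s) (by lia)
      ((Finset.univ : Finset (AddChar V ℂ)).val.map fun ψ => MvPolynomial.C z *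
        ∑ i, (∑ k, ψ (v (i, k)) * c k) • (MvPolynomial.X i : MvPolynomial (Fin n) ℂ))
      (fun l hl => by
        obtain ⟨ψ, -, rfl⟩ := Multiset.mem_map.mp hl
        have h := (MvPolynomial.isHomogeneous_C (Fin n) z).mul
          (MvPolynomial.IsHomogeneous.sum Finset.univ
            (fun i => (∑ k, ψ (v (i, k)) * c k) • (MvPolynomial.X i : MvPolynomial (Fin n) ℂ)) 1
            fun i _ => by
              rw [MvPolynomial.smul_eq_C_mul]
              exact MvPolynomial.isHomogeneous_C_mul_X _ _)
        simpa using h)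
    refine ⟨k, hk.trans ?_, ?_⟩
    · rw [Multiset.card_map, Finset.card_val, Finset.card_univ, AddChar.card_eq, ← mul_pow]
      refine hV.trans_eq ?_
      rw [Fintype.card_prod, Fintype.card_fin, Fintype.card_fin]
      ring
    · convert hdec using 1
      rw [Multiset.map_map]
      change _ = ∑ ψ : AddChar V ℂ, _
      simp only [Function.comp_apply, mul_pow]
      rw [← Finset.mul_sum, hsum, ← mul_assoc, ← map_pow, hz, ← map_mul, inv_mul_cancel₀ hκ0,
        map_one, one_mul]

/-! ### Passage to the limit -/

theorem tendsto_logb_const_mul_pow (c : ℝ) (hc : 0 < c) (s : ℕ) :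
    Tendsto (fun n : ℕ => Real.logb n (c * (n : ℝ) ^ s)) atTop (𝓝 s) := by
  have hlog : Tendsto (fun n : ℕ => Real.log n) atTop atTop :=
    Real.tendsto_log_atTop.comp tendsto_natCast_atTop_atTop
  have h : Tendsto (fun n : ℕ => Real.log c / Real.log n + s) atTop (𝓝 (0 + s)) :=
    (tendsto_const_nhds.div_atTop hlog).add_const _
  rw [zero_add] at h
  refine h.congr' ?_
  filter_upwards [eventually_ge_atTop 2] with n hn
  have hn1 : (1 : ℝ) < n := by exact_mod_cast hn
  have hn0 : (n : ℝ) ≠ 0 := by positivity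
  have hl : Real.log n ≠ 0 := (Real.log_pos hn1).ne'
  rw [Real.logb, Real.log_mul hc.ne' (pow_ne_zero _ hn0), Real.log_pow]
  field_simp

theorem tendsto_logb_of_choose_le {u : ℕ → ℕ} {s C : ℕ} (hC : 0 < C)
    (hu1 : ∀ n, 1 ≤ n → n.choose s ≤ u n) (hu2 : ∀ n, 1 ≤ n → u n ≤ C * n ^ s) :
    Tendsto (fun n : ℕ => Real.logb n (u n)) atTop (𝓝 s) := by
  have hc : (0 : ℝ) < 1 / (2 ^ s * s.factorial) := by positivity
  -- The threshold gives `n + 1 - s ≥ n / 2` and also `n > 1`, as base-`n` logarithms require.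
  have hlow : ∀ n : ℕ, 2 * s + 2 ≤ n →
      1 / (2 ^ s * s.factorial : ℝ) * (n : ℝ) ^ s ≤ u n := by
    intro n hn
    have hhalf : (n : ℝ) / 2 ≤ ((n + 1 - s : ℕ) : ℝ) := by
      rw [div_le_iff₀ two_pos]
      exact_mod_cast (by lia : n ≤ (n + 1 - s) * 2)
    calc 1 / (2 ^ s * s.factorial : ℝ) * (n : ℝ) ^ s
        = ((n : ℝ) / 2) ^ s / s.factorial := by rw [div_pow]; field_simp
      _ ≤ ((n + 1 - s : ℕ) : ℝ) ^ s / s.factorial := by gcongr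
      _ ≤ n.choose s := Nat.pow_le_choose s n
      _ ≤ u n := by exact_mod_cast hu1 n (by lia)
  refine tendsto_of_tendsto_of_tendsto_of_le_of_le' (tendsto_logb_const_mul_pow _ hc s)
    (tendsto_logb_const_mul_pow C (by exact_mod_cast hC) s) ?_ ?_
  · filter_upwards [eventually_ge_atTop (2 * s + 2)] with n hn
    have hn0 : (0 : ℝ) < n := by exact_mod_cast (by lia : 0 < n)
    exact Real.logb_le_logb_of_le (by exact_mod_cast (by lia : 1 < n)) (by positivity) (hlow n hn)
  · filter_upwards [eventually_ge_atTop (2 * s + 2)] with n hn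
    have hn0 : (0 : ℝ) < n := by exact_mod_cast (by lia : 0 < n)
    exact Real.logb_le_logb_of_le (by exact_mod_cast (by lia : 1 < n))
      (lt_of_lt_of_le (by positivity) (hlow n hn)) (by exact_mod_cast hu2 n (by lia))

theorem corollary1p2 (s : ℕ) :
    Tendsto (fun n : ℕ => Real.logb (n : ℝ) (waringRank (2 * s) (quadForm n ^ s) : ℝ))
        atTop (𝓝 (s : ℝ)) ∧
      Tendsto (fun n : ℕ => Real.logb (n : ℝ) (borderRank (2 * s) (quadForm n ^ s) : ℝ))
        atTop (𝓝 (s : ℝ)) := by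
  obtain ⟨C, hC, hdec⟩ := exists_hasWaringDecomposition_quadForm_pow s
  have hlow : ∀ n, 1 ≤ n → n.choose s ≤ borderRank (2 * s) (quadForm n ^ s) := fun n hn =>
    let ⟨_, _, h⟩ := hdec n hn
    choose_le_borderRank h
  have hmid : ∀ n, 1 ≤ n →
      borderRank (2 * s) (quadForm n ^ s) ≤ waringRank (2 * s) (quadForm n ^ s) := fun n hn =>
    let ⟨_, _, h⟩ := hdec n hn
    borderRank_le_waringRank (isHomogeneous_quadForm_pow n s) h
  have hup : ∀ n, 1 ≤ n → waringRank (2 * s) (quadForm n ^ s) ≤ C * n ^ s := fun n hn =>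
    let ⟨_, hk, h⟩ := hdec n hn
    (Nat.sInf_le h).trans hk
  exact ⟨tendsto_logb_of_choose_le hC (fun n hn => (hlow n hn).trans (hmid n hn)) hup,
    tendsto_logb_of_choose_le hC hlow fun n hn => (hmid n hn).trans (hup n hn)⟩
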